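/- Let $R$ be a commutative ring and $d\ge 0$ an integer. A $\mathbb Z/d\mathbb Z$-graded differential module is an $R$-module $D=\bigoplus_{j\in\mathbb Z/d\mathbb Z}D_j$ with an $R$-linear endomorphism $d^D$ such that $(d^D)^2=0$ and $d^D(D_j)\subseteq D_{j-1}$; put $H_j(D)=\ker(d^D|_{D_j})/d^D(D_{j+1})$. A morphism is an $R$-linear map of degree $0$ commuting with the differentials; it is a quasi-isomorphism if it induces isomorphisms on all $H_j$. Morphisms $f,g:D\to D'$ are homotopic if $f-g=d^{D'}h+hd^D$ for an $R$-linear map $h$ with $h(D_j)\subseteq D'_{j+1}$. A flag is such a module $F$ with filtrations $0=F^{-1}_j\subseteq F^0_j\subseteq F^1_j\subseteq\cdots$, $\bigcup_iF^i_j=F_j$, such that $d^F(F^i_j)\subseteq F^{i-1}_{j-1}$. It is projective if all $F^i_k/F^{i-1}_k$ are projective. With $F_{i,j}=F^i_{i+j}/F^{i-1}_{i+j}$, its anchor is the direct sum over $j\in\mathbb Z/d\mathbb Z$ of the complexes $\cdots\to F_{2,j}\to F_{1,j}\to F_{0,j}$ with the maps induced by $d^F$. A morphism $f:F\to F'$ of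 differential modules between flags is flag-preserving if $f(F^i_j)\subseteq F'^i_j$ for all $i,j$, and a homotopy $h$ is flag-preserving if $h(F^i_j)\subseteq F'^{i+1}_{j+1}$ for all $i,j$. An anchored resolution of $D$ is a projective flag $F$ with a quasi-isomorphism $F\to D$ (the augmentation) such that, for every $j$, the complex $F_{\bullet,j}$ is a projective resolution of $H_j(D)$. **Theorem.** 1. Every $\mathbb Z/d\mathbb Z$-graded differential module has an anchored resolution. If $\phi:D\to D'$ is a morphism of $\mathbb Z/d\mathbb Z$-graded differential modules and $\varepsilon:F\to D$, $\varepsilon':F'\to D'$ are any anchored resolutions, then there is a flag-preserving morphism $\widetilde\phi:F\to F'$ such that $\varepsilon'\widetilde\phi$ and $\phi\varepsilon$ are homotopic. 2. Any two anchored resolutions $F,F'$ of a fixed differential module $D$ are homotopy equivalent in a flag-preserving way: there are flag-preserving morphisms $f:F\to F'$ and $g:F'\to F$ such that $gf$ and $fg$ are homotopic to the identities by flag-preserving homotopies. -/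

import Mathlib

universe u v

/-- A `ℤ/d`-graded differential `R`-module: an `R`-module with a direct sum decomposition
`D = ⨁ j, D_j` indexed by `ℤ/d` and a square-zero endomorphism of degree `-1`.
Since `ZMod 0 = ℤ`, the case `d = 0` is that of (unbounded) chain complexes. -/
structure GrDiffMod (R : Type u) [CommRing R] (d : ℕ) where
  carrier : Type v
  [addCommGroup : AddCommGroup carrier]
  [module : Module R carrier]
  /-- the graded piece `D_j` -/
  grade : ZMod d → Submodule R carrier
  isInternal : DirectSum.IsInternal grade
  /-- the differential -/
  diff : carrier →ₗ[R] carrier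
  diff_diff : ∀ x, diff (diff x) = 0
  diff_mem : ∀ j, ∀ x ∈ grade j, diff x ∈ grade (j - 1)

attribute [instance] GrDiffMod.addCommGroup GrDiffMod.module

namespace GrDiffMod

variable {R : Type u} [CommRing R] {d : ℕ}

/-- A morphism of `ℤ/d`-graded differential modules: an `R`-linear map of degree `0` that commutes
with the differentials. -/
structure Hom (D D' : GrDiffMod.{u, v} R d) where
  toLin : D.carrier →ₗ[R] D'.carrier
  map_mem : ∀ j, ∀ x ∈ D.grade j, toLin x ∈ D'.grade j
  comm : ∀ x, D'.diff (toLin x) = toLin (D.diff x)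

/-- The identity morphism. -/
def Hom.id (D : GrDiffMod.{u, v} R d) : Hom D D where
  toLin := LinearMap.id
  map_mem := fun _ _ hx => hx
  comm := fun _ => rfl

/-- The composite `g ∘ f` of morphisms. -/
def Hom.comp {D D' D'' : GrDiffMod.{u, v} R d} (g : Hom D' D'') (f : Hom D D') : Hom D D'' where
  toLin := g.toLin ∘ₗ f.toLin
  map_mem := fun j x hx => g.map_mem j _ (f.map_mem j x hx)
  comm := fun x => by simp [g.comm, f.comm]

/-- `f` and `g` are homotopic: `f - g = d h + h d` for some `R`-linear map `h` of degree `1`. -/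
def Homotopic {D D' : GrDiffMod.{u, v} R d} (f g : Hom D D') : Prop :=
  ∃ h : D.carrier →ₗ[R] D'.carrier,
    (∀ j, ∀ x ∈ D.grade j, h x ∈ D'.grade (j + 1)) ∧
    ∀ x, f.toLin x - g.toLin x = D'.diff (h x) + h (D.diff x)

/-- The cycles `Z_j(D) = ker (d : D_j → D_{j-1})`. -/
def cycles (D : GrDiffMod.{u, v} R d) (j : ZMod d) : Submodule R D.carrier :=
  D.grade j ⊓ LinearMap.ker D.diff

/-- The boundaries `B_j(D) = im (d : D_{j+1} → D_j)`. -/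
def boundaries (D : GrDiffMod.{u, v} R d) (j : ZMod d) : Submodule R D.carrier :=
  (D.grade (j + 1)).map D.diff

/-- The homology `H_j(D) = Z_j(D) / B_j(D)`. -/
abbrev homology (D : GrDiffMod.{u, v} R d) (j : ZMod d) : Type v :=
  D.cycles j ⧸ (D.boundaries j).submoduleOf (D.cycles j)

theorem Hom.map_cycles {D D' : GrDiffMod.{u, v} R d} (f : Hom D D') (j : ZMod d) :
    ∀ x ∈ D.cycles j, f.toLin x ∈ D'.cycles j := by
  rintro x ⟨hx, hd⟩
  refine ⟨f.map_mem j x hx, ?_⟩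
  have hd' : D.diff x = 0 := hd
  change D'.diff (f.toLin x) = 0
  rw [f.comm, hd', map_zero]

theorem Hom.map_boundaries {D D' : GrDiffMod.{u, v} R d} (f : Hom D D') (j : ZMod d) :
    ∀ x ∈ D.boundaries j, f.toLin x ∈ D'.boundaries j := by
  rintro _ ⟨y, hy, rfl⟩
  exact ⟨f.toLin y, f.map_mem _ y hy, f.comm y⟩

/-- The map `H_j(D) → H_j(D')` induced by a morphism. -/
def Hom.homologyMap {D D' : GrDiffMod.{u, v} R d} (f : Hom D D') (j : ZMod d) :
    D.homology j →ₗ[R] D'.homology j :=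
  Submodule.mapQ _ _ (f.toLin.restrict (f.map_cycles j)) (by
    intro x hx
    exact f.map_boundaries j _ hx)

/-- A quasi-isomorphism is a morphism that induces an isomorphism on homology. -/
def Hom.IsQuasiIso {D D' : GrDiffMod.{u, v} R d} (f : Hom D D') : Prop :=
  ∀ j, Function.Bijective (f.homologyMap j)

end GrDiffMod

/-- A `ℤ/d`-graded flag: a `ℤ/d`-graded differential module together with an exhaustive filtration
`0 = D^{-1}_j ⊆ D^0_j ⊆ D^1_j ⊆ ⋯` of each `D_j` such that `d (D^i_j) ⊆ D^{i-1}_{j-1}`. -/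
structure GrFlag (R : Type u) [CommRing R] (d : ℕ) extends GrDiffMod.{u, v} R d where
  /-- the filtration piece `D^i_j` -/
  fil : ℕ → ZMod d → Submodule R carrier
  fil_le_grade : ∀ i j, fil i j ≤ grade j
  fil_le_succ : ∀ i j, fil i j ≤ fil (i + 1) j
  exhaustive : ∀ j, ∀ x ∈ grade j, ∃ i, x ∈ fil i j
  diff_fil_zero : ∀ j, ∀ x ∈ fil 0 j, diff x = 0
  diff_fil_succ : ∀ i j, ∀ x ∈ fil (i + 1) j, diff x ∈ fil i (j - 1)

namespace GrFlag

variable {R : Type u} [CommRing R] {d : ℕ}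

/-- The filtration piece `D^{i-1}_j`, which is `0` for `i = 0`. -/
def filPred (F : GrFlag.{u, v} R d) : ℕ → ZMod d → Submodule R F.carrier
  | 0, _ => ⊥
  | i + 1, j => F.fil i j

/-- The associated graded piece `D^i_k / D^{i-1}_k`. -/
abbrev gr (F : GrFlag.{u, v} R d) (i : ℕ) (k : ZMod d) : Type v :=
  F.fil i k ⧸ (F.filPred i k).submoduleOf (F.fil i k)

theorem diff_fil_succ' (F : GrFlag.{u, v} R d) (i : ℕ) (k l : ZMod d) (h : k = l + 1) :
    ∀ x ∈ F.fil (i + 1) k, F.diff x ∈ F.fil i l := by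
  intro x hx
  subst h
  simpa using F.diff_fil_succ i _ x hx

theorem diff_filPred_succ (F : GrFlag.{u, v} R d) (i : ℕ) (k l : ZMod d) (h : k = l + 1) :
    ∀ x ∈ F.filPred (i + 1) k, F.diff x ∈ F.filPred i l := by
  intro x hx
  cases i with
  | zero => exact (Submodule.mem_bot R).2 (F.diff_fil_zero k x hx)
  | succ i => exact F.diff_fil_succ' i k l h x hx

/-- The map `D^{i+1}_k / D^i_k → D^i_{k-1} / D^{i-1}_{k-1}` induced by the differential. -/
def grDiff (F : GrFlag.{u, v} R d) (i : ℕ) (k l : ZMod d) (h : k = l + 1) :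
    F.gr (i + 1) k →ₗ[R] F.gr i l :=
  Submodule.mapQ _ _ (F.diff.restrict (F.diff_fil_succ' i k l h)) (by
    intro x hx
    exact F.diff_filPred_succ i k l h _ hx)

/-- The term `D_{i,j} = D^i_{i+j} / D^{i-1}_{i+j}` of the anchor; it has `ℤ/d`-degree `i + j`. -/
abbrev anchor (F : GrFlag.{u, v} R d) (j : ZMod d) (i : ℕ) : Type v :=
  F.gr i ((i : ZMod d) + j)

/-- The differential `δ₀ : D_{i+1,j} → D_{i,j}` of the anchor complex
`⋯ → D_{2,j} → D_{1,j} → D_{0,j}`. -/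
def anchorDiff (F : GrFlag.{u, v} R d) (j : ZMod d) (i : ℕ) :
    F.anchor j (i + 1) →ₗ[R] F.anchor j i :=
  F.grDiff i _ _ (by push_cast; ring)

/-- A flag is projective if all its associated graded pieces are projective `R`-modules. -/
def IsProjective (F : GrFlag.{u, v} R d) : Prop :=
  ∀ i k, Module.Projective R (F.gr i k)

/-- The complex `⋯ → D_{2,j} → D_{1,j} → D_{0,j}` (a summand of the anchor) is a projective
resolution of the module `M`: its terms are projective, and for some augmentation
`D_{0,j} → M` the sequence `⋯ → D_{2,j} → D_{1,j} → D_{0,j} → M → 0` is exact. -/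
def AnchorResolves (F : GrFlag.{u, v} R d) (j : ZMod d) (M : Type v) [AddCommGroup M]
    [Module R M] : Prop :=
  (∀ i, Module.Projective R (F.anchor j i)) ∧
  (∀ i, Function.Exact (F.anchorDiff j (i + 1)) (F.anchorDiff j i)) ∧
  ∃ π : F.anchor j 0 →ₗ[R] M, Function.Exact (F.anchorDiff j 0) π ∧ Function.Surjective π

/-- A morphism of the underlying differential modules is flag-preserving if it maps `D^i_j` into
`D'^i_j`. -/
def FlagPreserving {F F' : GrFlag.{u, v} R d} (f : GrDiffMod.Hom F.toGrDiffMod F'.toGrDiffMod) :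
    Prop :=
  ∀ i j, ∀ x ∈ F.fil i j, f.toLin x ∈ F'.fil i j

/-- `f` and `g` are homotopic by a flag-preserving homotopy: `f - g = d h + h d` for some
`R`-linear map `h` that maps `D^i_j` into `D'^{i+1}_{j+1}`. -/
def FlagHomotopic {F F' : GrFlag.{u, v} R d} (f g : GrDiffMod.Hom F.toGrDiffMod F'.toGrDiffMod) :
    Prop :=
  ∃ h : F.carrier →ₗ[R] F'.carrier,
    (∀ i j, ∀ x ∈ F.fil i j, h x ∈ F'.fil (i + 1) (j + 1)) ∧
    ∀ x, f.toLin x - g.toLin x = F'.diff (h x) + h (F.diff x)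

/-- Two flags are homotopy equivalent in a flag-preserving way: there are flag-preserving morphisms
in both directions whose composites are homotopic to the identities by flag-preserving
homotopies. -/
def FlagHomotopyEquivalent (F F' : GrFlag.{u, v} R d) : Prop :=
  ∃ (f : GrDiffMod.Hom F.toGrDiffMod F'.toGrDiffMod)
    (g : GrDiffMod.Hom F'.toGrDiffMod F.toGrDiffMod),
    FlagPreserving f ∧ FlagPreserving g ∧
    FlagHomotopic (g.comp f) (GrDiffMod.Hom.id F.toGrDiffMod) ∧
    FlagHomotopic (f.comp g) (GrDiffMod.Hom.id F'.toGrDiffMod)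

end GrFlag

/-- An anchored resolution of a `ℤ/d`-graded differential module `D`: a projective flag `F` with a
quasi-isomorphism `F → D` of differential modules (not required to respect any filtration), whose
anchor is a projective resolution of the homology `H(D) = ⨁ j, H_j(D)`. -/
structure AnchoredResolution {R : Type u} [CommRing R] {d : ℕ} (D : GrDiffMod.{u, v} R d) where
  flag : GrFlag.{u, v} R d
  aug : GrDiffMod.Hom flag.toGrDiffMod D
  isQuasiIso : aug.IsQuasiIso
  isProjective : flag.IsProjective
  anchorResolves : ∀ j, flag.AnchorResolves j (D.homology j)

/-!
Everything is read off the mapping cone `F × D` of an augmentation `ε : F → D`, filtered by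
`F^{n-1}_{k-1} × D_k`. A quasi-isomorphism `ε` from a flag with exact anchor makes the cone acyclic
in the filtered sense that a cycle in level `n` bounds in level `n + 1`; conversely, this acyclicity
makes `ε` a quasi-isomorphism and the anchor a resolution of the homology.

A projective flag admits, level by level, a contraction of every filtered map into such a complex.
Contracting the map `(0, φ)` into the cone of `ε'` lifts `φ` along `ε'`, and contracting
`(f - g, s)`, with `s` a homotopy from `ε' f` to `ε' g`, gives a flag-preserving homotopy from `f`
to `g`. For existence, one attaches a free cell for every cycle of the cone, so that the cone is
acyclic by construction.
-/

universe w

section Extension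

variable {R M C C' : Type*} [Ring R] [AddCommGroup M] [Module R M] [AddCommGroup C] [Module R C]
  [AddCommGroup C'] [Module R C']

theorem exists_lift_extending_of_projective_quotient (N : Submodule R M)
    [Module.Projective R (M ⧸ N)] {δ : C →ₗ[R] C'} {t : M →ₗ[R] C'} {f : N →ₗ[R] C}
    (ht : ∀ x, t x ∈ LinearMap.range δ) (hf : ∀ x : N, δ (f x) = t x) :
    ∃ f' : M →ₗ[R] C, (∀ x : N, f' x = f x) ∧ ∀ x, δ (f' x) = t x := by
  obtain ⟨s, hs⟩ := N.mkQ.exists_rightInverse_of_surjective N.range_mkQ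
  obtain ⟨q, hq⟩ := Module.projective_lifting_property δ.rangeRestrict
    ((t ∘ₗ s).codRestrict _ fun x => ht (s x)) δ.surjective_rangeRestrict
  have mkQ_s : ∀ x, N.mkQ (s x) = x := LinearMap.congr_fun hs
  have δ_q : ∀ x, δ (q x) = t (s x) := fun x => congrArg Subtype.val (LinearMap.congr_fun hq x)
  let r : M →ₗ[R] N := (LinearMap.id - s ∘ₗ N.mkQ).codRestrict N fun x =>
    (Submodule.Quotient.mk_eq_zero N).1 <| show N.mkQ (x - s (N.mkQ x)) = 0 by
      rw [map_sub, mkQ_s, sub_self]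
  have r_coe : ∀ x, (r x : M) = x - s (N.mkQ x) := fun _ => rfl
  refine ⟨f ∘ₗ r + q ∘ₗ N.mkQ, fun x => ?_, fun x => ?_⟩
  · have hx : N.mkQ (x : M) = 0 := (Submodule.Quotient.mk_eq_zero N).2 x.2
    have r_x : r x = x := Subtype.ext (by rw [r_coe, hx, map_zero, sub_zero])
    rw [LinearMap.add_apply, LinearMap.comp_apply, LinearMap.comp_apply, hx, map_zero, add_zero,
      r_x]
  · rw [LinearMap.add_apply, LinearMap.comp_apply, LinearMap.comp_apply, map_add, hf, δ_q,
      ← map_add, r_coe, sub_add_cancel]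

theorem exists_linearMap_iSup_of_chain {N : ℕ → Submodule R M} (hN : ∀ n, N n ≤ N (n + 1))
    (f : ∀ n, N n →ₗ[R] C) (hf : ∀ n (x : N n), f (n + 1) ⟨x, hN n x.2⟩ = f n x) :
    ∃ g : ↥(⨆ n, N n) →ₗ[R] C, ∀ n (x : N n), g ⟨x, le_iSup N n x.2⟩ = f n x := by
  let p : ℕ → M →ₗ.[R] C := fun n => ⟨N n, f n⟩
  have p_mono : Monotone p := monotone_nat_of_le_succ fun n => ⟨hN n, fun x y hxy => by
    obtain rfl : y = ⟨x, hN n x.2⟩ := Subtype.ext hxy.symm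
    exact (hf n x).symm⟩
  have p_dir : DirectedOn (· ≤ ·) (Set.range p) := p_mono.directed_le.directedOn_range
  have le_domain : ⨆ n, N n ≤ (LinearPMap.sSup _ p_dir).domain :=
    iSup_le fun n => (LinearPMap.le_sSup p_dir ⟨n, rfl⟩).1
  exact ⟨(LinearPMap.sSup _ p_dir).toFun ∘ₗ Submodule.inclusion le_domain, fun n x =>
    ((LinearPMap.le_sSup p_dir ⟨n, rfl⟩).2 rfl).symm⟩

theorem exists_linearMap_of_isInternal {ι : Type*} [DecidableEq ι] {G : ι → Submodule R M}
    (hG : DirectSum.IsInternal G) (f : ∀ i, G i →ₗ[R] C) :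
    ∃ g : M →ₗ[R] C, ∀ i (x : G i), g x = f i x := by
  let := hG.chooseDecomposition
  refine ⟨DirectSum.toModule R ι C f ∘ₗ (DirectSum.decomposeLinearEquiv G).toLinearMap,
    fun i x => ?_⟩
  rw [LinearMap.comp_apply, LinearEquiv.coe_coe, DirectSum.decomposeLinearEquiv_apply,
    DirectSum.decompose_coe]
  exact DirectSum.toModule_lof R (φ := f) i x

end Extension

namespace GrFlag

section Basic

variable {R : Type u} [CommRing R] {d : ℕ} (F : GrFlag.{u, v} R d)

theorem filPred_le_fil (n : ℕ) (k : ZMod d) : F.filPred n k ≤ F.fil n k := by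
  cases n with
  | zero => exact bot_le
  | succ n => exact F.fil_le_succ n k

theorem fil_mono (k : ZMod d) : Monotone fun n => F.fil n k :=
  monotone_nat_of_le_succ fun n => F.fil_le_succ n k

theorem filPred_mono (k : ZMod d) : Monotone fun n => F.filPred n k :=
  monotone_nat_of_le_succ fun n => F.filPred_le_fil n k

theorem diff_mem_filPred {n : ℕ} {k : ZMod d} {x : F.carrier} (hx : x ∈ F.fil n k) :
    F.diff x ∈ F.filPred n (k - 1) :=
  F.diff_filPred_succ n k (k - 1) (sub_add_cancel k 1).symm x hx

theorem iSup_fil (k : ZMod d) : ⨆ n, F.fil n k = F.grade k :=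
  le_antisymm (iSup_le fun n => F.fil_le_grade n k) fun x hx =>
    (Submodule.mem_iSup_of_directed _ (F.fil_mono k).directed_le).2 (F.exhaustive k x hx)

variable {F} {C : Type*} [AddCommGroup C] [Module R C]

theorem linearMap_ext {f g : F.carrier →ₗ[R] C} (h : ∀ n k, ∀ x ∈ F.fil n k, f x = g x) :
    f = g := by
  have le_eqLocus : ⨆ k, F.grade k ≤ LinearMap.eqLocus f g :=
    iSup_le fun k => F.iSup_fil k ▸ iSup_le fun n => h n k
  rw [F.isInternal.submodule_iSup_eq_top] at le_eqLocus
  exact LinearMap.ext fun x => le_eqLocus trivial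

theorem exists_linearMap (f : ∀ n k, F.fil n k →ₗ[R] C)
    (hf : ∀ n k (x : F.fil n k), f (n + 1) k ⟨x, F.fil_le_succ n k x.2⟩ = f n k x) :
    ∃ g : F.carrier →ₗ[R] C, ∀ n k (x : F.fil n k), g x = f n k x := by
  choose g hg using fun k => exists_linearMap_iSup_of_chain (fun n => F.fil_le_succ n k)
    (fun n => f n k) fun n => hf n k
  obtain ⟨G, hG⟩ := exists_linearMap_of_isInternal F.isInternal fun k =>
    g k ∘ₗ Submodule.inclusion (F.iSup_fil k).ge
  exact ⟨G, fun n k x => (hG k ⟨x, F.fil_le_grade n k x.2⟩).trans (hg k n x)⟩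

end Basic

section Contraction

variable {R : Type u} [CommRing R] {d : ℕ} {C : Type*} [AddCommGroup C] [Module R C]

/-- Acyclicity of `(C, δ)` relative to an increasing family `A n k` of submodules, where `n` is the
filtration level and `k` the degree: a cycle in level `n` bounds in level `n + 1`. -/
structure FilteredAcyclic (δ : C →ₗ[R] C) (A : ℕ → ZMod d → Submodule R C) : Prop where
  le_succ : ∀ n k, A n k ≤ A (n + 1) k
  exists_diff_eq : ∀ n k, ∀ c ∈ A n k, δ c = 0 → ∃ c' ∈ A (n + 1) (k + 1), δ c' = c

theorem FilteredAcyclic.neg {δ : C →ₗ[R] C} {A : ℕ → ZMod d → Submodule R C}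
    (h : FilteredAcyclic δ A) : FilteredAcyclic (-δ) A where
  le_succ := h.le_succ
  exists_diff_eq n k c hc hδc := by
    obtain ⟨c', hc', rfl⟩ := h.exists_diff_eq n k c hc (neg_eq_zero.1 hδc)
    exact ⟨-c', neg_mem hc', by rw [LinearMap.neg_apply, map_neg, neg_neg]⟩

theorem FilteredAcyclic.shift {δ : C →ₗ[R] C} {A : ℕ → ZMod d → Submodule R C}
    (h : FilteredAcyclic δ A) : FilteredAcyclic δ fun n k => A (n + 1) (k + 1) where
  le_succ n k := h.le_succ (n + 1) (k + 1)
  exists_diff_eq n k := h.exists_diff_eq (n + 1) (k + 1)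

variable {F : GrFlag.{u, v} R d}

/-- A null-homotopy of `g : F → C` defined on level `n - 1` of the flag only, of degree `1` with
respect to the family `A` of submodules of `C`. -/
structure IsPartialContraction (δ : C →ₗ[R] C) (A : ℕ → ZMod d → Submodule R C)
    (g : F.carrier →ₗ[R] C) (n : ℕ) (f : ∀ k, F.filPred n k →ₗ[R] C) : Prop where
  mem : ∀ k x, f k x ∈ A n (k + 1)
  eq : ∀ k (x : F.filPred n k),
    g x = δ (f k x) + f (k - 1) ⟨F.diff x, F.diff_mem_filPred (F.filPred_le_fil n k x.2)⟩

variable {δ : C →ₗ[R] C} {A : ℕ → ZMod d → Submodule R C} {g : F.carrier →ₗ[R] C} {n : ℕ}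
  {f : ∀ k, F.filPred n k →ₗ[R] C}

theorem isPartialContraction_zero : IsPartialContraction δ A g 0 fun _ => 0 where
  mem _ _ := zero_mem _
  eq k x := by
    obtain ⟨_, rfl⟩ := x
    simp only [map_zero, LinearMap.zero_apply, add_zero]

theorem IsPartialContraction.exists_diff_eq (hf : IsPartialContraction δ A g n f)
    (hA : FilteredAcyclic δ A) (hg : ∀ x, δ (g x) = g (F.diff x))
    (hgA : ∀ n k, ∀ x ∈ F.fil n k, g x ∈ A n k) (k : ZMod d) (x : F.fil n k) :
    ∃ c ∈ A (n + 1) (k + 1), δ c = g x - f (k - 1) ⟨F.diff x, F.diff_mem_filPred x.2⟩ := by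
  have hfA : f (k - 1) ⟨F.diff x, F.diff_mem_filPred x.2⟩ ∈ A n k := by
    simpa only [sub_add_cancel] using hf.mem (k - 1) _
  refine hA.exists_diff_eq n k _ (sub_mem (hgA n k x x.2) hfA) ?_
  have h := hf.eq (k - 1) ⟨F.diff x, F.diff_mem_filPred x.2⟩
  simp only [F.diff_diff] at h
  rw [show (⟨0, _⟩ : F.filPred n (k - 1 - 1)) = 0 from rfl, map_zero, add_zero] at h
  rw [map_sub, hg, h, sub_self]

theorem IsPartialContraction.exists_extension (hf : IsPartialContraction δ A g n f)
    (hF : F.IsProjective) (hA : FilteredAcyclic δ A) (hg : ∀ x, δ (g x) = g (F.diff x))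
    (hgA : ∀ n k, ∀ x ∈ F.fil n k, g x ∈ A n k) :
    ∃ f' : ∀ k, F.fil n k →ₗ[R] C, IsPartialContraction δ A g (n + 1) f' ∧
      ∀ k (x : F.filPred n k), f' k ⟨x, F.filPred_le_fil n k x.2⟩ = f k x := by
  have extend (k : ZMod d) : ∃ f' : F.fil n k →ₗ[R] A (n + 1) (k + 1),
      (∀ x : F.filPred n k, (f' ⟨x, F.filPred_le_fil n k x.2⟩ : C) = f k x) ∧
      ∀ x, δ (f' x) = g x - f (k - 1) ⟨F.diff x, F.diff_mem_filPred x.2⟩ := by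
    have := hF n k
    have f_mem (x) : f k x ∈ A (n + 1) (k + 1) := hA.le_succ n _ (hf.mem k x)
    obtain ⟨f', hf', hδ⟩ := exists_lift_extending_of_projective_quotient
      ((F.filPred n k).submoduleOf (F.fil n k)) (δ := δ.domRestrict (A (n + 1) (k + 1)))
      (t := g ∘ₗ (F.fil n k).subtype -
        f (k - 1) ∘ₗ F.diff.restrict fun _ => F.diff_mem_filPred)
      (f := (f k).codRestrict _ f_mem ∘ₗ
        (Submodule.submoduleOfEquivOfLe (F.filPred_le_fil n k)).toLinearMap)
      (fun x => by
        obtain ⟨c, hc, h⟩ := hf.exists_diff_eq hA hg hgA k x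
        exact ⟨⟨c, hc⟩, h⟩)
      fun x => (sub_eq_of_eq_add (hf.eq k ⟨x, x.2⟩)).symm
    exact ⟨f', fun x => congrArg Subtype.val (hf' ⟨⟨x, F.filPred_le_fil n k x.2⟩, x.2⟩), hδ⟩
  choose f' hf' hδ using extend
  refine ⟨fun k => Submodule.subtype _ ∘ₗ f' k, ⟨fun k x => (f' k x).2, fun k x => ?_⟩, hf'⟩
  calc g x = δ (f' k x) + f (k - 1) ⟨F.diff x, F.diff_mem_filPred x.2⟩ :=
        sub_eq_iff_eq_add.1 (hδ k x).symm
    _ = _ := congrArg _ (hf' (k - 1) ⟨F.diff x, F.diff_mem_filPred x.2⟩).symm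

theorem IsProjective.exists_contraction (hF : F.IsProjective) (hA : FilteredAcyclic δ A)
    (hg : ∀ x, δ (g x) = g (F.diff x)) (hgA : ∀ n k, ∀ x ∈ F.fil n k, g x ∈ A n k) :
    ∃ H : F.carrier →ₗ[R] C, (∀ n k, ∀ x ∈ F.fil n k, H x ∈ A (n + 1) (k + 1)) ∧
      ∀ x, g x = δ (H x) + H (F.diff x) := by
  choose next next_isPartial next_extends using
    fun n (f : {f // IsPartialContraction δ A g n f}) => f.2.exists_extension hF hA hg hgA
  let f : ∀ n, {f // IsPartialContraction δ A g n f} :=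
    Nat.rec ⟨_, isPartialContraction_zero⟩ fun n f => ⟨next n f, next_isPartial n f⟩
  obtain ⟨H, hH⟩ := F.exists_linearMap (fun n => (f (n + 1)).1)
    fun n => next_extends (n + 1) (f (n + 1))
  refine ⟨H, fun n k x hx => ?_, LinearMap.congr_fun (g := δ ∘ₗ H + H ∘ₗ F.diff)
    (linearMap_ext fun n k x hx => ?_)⟩
  · rw [hH n k ⟨x, hx⟩]
    exact (f (n + 1)).2.mem k _
  · calc g x = δ ((f (n + 1)).1 k ⟨x, hx⟩) + (f (n + 1)).1 (k - 1) ⟨F.diff x, _⟩ :=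
          (f (n + 1)).2.eq k ⟨x, hx⟩
      _ = δ (H x) + H (F.diff x) := congrArg₂ (fun a b => δ a + b) (hH n k ⟨x, hx⟩).symm
        (hH n (k - 1) ⟨F.diff x, F.filPred_le_fil _ _ (F.diff_mem_filPred hx)⟩).symm

end Contraction

end GrFlag

namespace GrDiffMod

variable {R : Type u} [CommRing R] {d : ℕ} {D D' D'' : GrDiffMod.{u, v} R d}

theorem Homotopic.trans {f g h : Hom D D'} (hfg : Homotopic f g) (hgh : Homotopic g h) :
    Homotopic f h := by
  obtain ⟨a, ha, ha'⟩ := hfg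
  obtain ⟨b, hb, hb'⟩ := hgh
  refine ⟨a + b, fun j x hx => add_mem (ha j x hx) (hb j x hx), fun x => ?_⟩
  rw [← sub_add_sub_cancel _ (g.toLin x), ha', hb']
  simp only [LinearMap.add_apply, map_add]
  abel

theorem Homotopic.comp_right {f g : Hom D' D''} (hfg : Homotopic f g) (e : Hom D D') :
    Homotopic (f.comp e) (g.comp e) := by
  obtain ⟨a, ha, ha'⟩ := hfg
  refine ⟨a ∘ₗ e.toLin, fun j x hx => ha j _ (e.map_mem j x hx), fun x => ?_⟩
  simpa only [Hom.comp, LinearMap.comp_apply, e.comm] using ha' (e.toLin x)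

theorem Hom.homologyMap_injective_iff (f : Hom D D') (j : ZMod d) :
    Function.Injective (f.homologyMap j) ↔
      ∀ x ∈ D.cycles j, f.toLin x ∈ D'.boundaries j → x ∈ D.boundaries j := by
  rw [injective_iff_map_eq_zero, Submodule.Quotient.mk_surjective _ |>.forall, Subtype.forall]
  refine forall₂_congr fun x hx => imp_congr ?_ ?_ <;> exact Submodule.Quotient.mk_eq_zero _

theorem Hom.homologyMap_surjective_iff (f : Hom D D') (j : ZMod d) :
    Function.Surjective (f.homologyMap j) ↔
      ∀ y ∈ D'.cycles j, ∃ x ∈ D.cycles j, f.toLin x - y ∈ D'.boundaries j := by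
  rw [Function.Surjective, Submodule.Quotient.mk_surjective _ |>.forall, Subtype.forall]
  refine forall₂_congr fun y hy => ?_
  rw [Submodule.Quotient.mk_surjective _ |>.exists, Subtype.exists]
  exact exists_congr fun x => (exists_congr fun hx => Submodule.Quotient.eq _).trans
    (exists_prop (b := f.toLin x - y ∈ D'.boundaries j))

/-- The differential `(y, w) ↦ (d y, f y - d w)` of the mapping cone of `f`, on `D × D'`. -/
def Hom.coneDiff (f : Hom D D') : D.carrier × D'.carrier →ₗ[R] D.carrier × D'.carrier :=
  (D.diff ∘ₗ LinearMap.fst R _ _).prod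
    (f.toLin ∘ₗ LinearMap.fst R _ _ - D'.diff ∘ₗ LinearMap.snd R _ _)

theorem Hom.coneDiff_apply (f : Hom D D') (c : D.carrier × D'.carrier) :
    f.coneDiff c = (D.diff c.1, f.toLin c.1 - D'.diff c.2) :=
  rfl

end GrDiffMod

namespace GrFlag

open GrDiffMod

variable {R : Type u} [CommRing R] {d : ℕ}

section Anchor

variable {F : GrFlag.{u, v} R d}

/-- The anchor of `F` is acyclic in positive degrees. -/
def AnchorExact (F : GrFlag.{u, v} R d) : Prop :=
  ∀ j i, Function.Exact (F.anchorDiff j (i + 1)) (F.anchorDiff j i)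

theorem exact_grDiff_iff {i : ℕ} {k₂ k₁ k₀ : ZMod d} (h₂ : k₂ = k₁ + 1) (h₁ : k₁ = k₀ + 1) :
    Function.Exact (F.grDiff (i + 1) k₂ k₁ h₂) (F.grDiff i k₁ k₀ h₁) ↔
      ∀ x ∈ F.fil (i + 1) k₁, F.diff x ∈ F.filPred i k₀ →
        ∃ z ∈ F.fil (i + 2) k₂, F.diff z - x ∈ F.fil i k₁ := by
  have grDiff_comp : F.grDiff i k₁ k₀ h₁ ∘ₗ F.grDiff (i + 1) k₂ k₁ h₂ = 0 :=
    Submodule.linearMap_qext _ <| LinearMap.ext fun x => congrArg Submodule.Quotient.mk <|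
      Subtype.ext (F.diff_diff x)
  rw [LinearMap.exact_iff, le_antisymm_iff, and_iff_left (LinearMap.range_le_ker_iff.2 grDiff_comp),
    SetLike.le_def, Submodule.Quotient.mk_surjective _ |>.forall, Subtype.forall]
  refine forall₂_congr fun x hx => imp_congr (Submodule.Quotient.mk_eq_zero _) ?_
  rw [LinearMap.mem_range, Submodule.Quotient.mk_surjective _ |>.exists, Subtype.exists]
  exact exists_congr fun z => (exists_congr fun hz => Submodule.Quotient.eq _).trans
    (exists_prop (b := F.diff z - x ∈ F.fil i k₁))

theorem anchorExact_iff :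
    F.AnchorExact ↔ ∀ i k, ∀ x ∈ F.fil (i + 1) k, F.diff x ∈ F.filPred i (k - 1) →
      ∃ z ∈ F.fil (i + 2) (k + 1), F.diff z - x ∈ F.fil i k := by
  have degree (i : ℕ) (j k : ZMod d) (hk : ((i + 1 : ℕ) : ZMod d) + j = k) :
      Function.Exact (F.anchorDiff j (i + 1)) (F.anchorDiff j i) ↔
        ∀ x ∈ F.fil (i + 1) k, F.diff x ∈ F.filPred i (k - 1) →
          ∃ z ∈ F.fil (i + 2) (k + 1), F.diff z - x ∈ F.fil i k := by
    have h₀ : k - 1 = i + j := by rw [← hk]; push_cast; ring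
    have h₂ : k + 1 = (i + 2 : ℕ) + j := by rw [← hk]; push_cast; ring
    rw [h₀, h₂, ← hk]
    exact exact_grDiff_iff _ _
  exact ⟨fun h i k => (degree i (k - (i + 1 : ℕ)) k (add_sub_cancel _ _)).1 (h _ i),
    fun h j i => (degree i j _ rfl).2 (h i _)⟩

theorem AnchorExact.exists_mem_fil_diff_eq (hF : F.AnchorExact) {n : ℕ} {k : ZMod d}
    {y : F.carrier} (hy : y ∈ F.grade k) (hdy : F.diff y ∈ F.filPred n (k - 1)) :
    ∃ y' ∈ F.fil n k, F.diff y' = F.diff y := by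
  obtain ⟨m, hm⟩ := F.exhaustive k y hy
  induction m generalizing y with
  | zero => exact ⟨y, F.fil_mono k n.zero_le hm, rfl⟩
  | succ m ih =>
    rcases le_or_gt (m + 1) n with h | h
    · exact ⟨y, F.fil_mono k h hm, rfl⟩
    · obtain ⟨z, -, hz⟩ :=
        anchorExact_iff.1 hF m k y hm (F.filPred_mono _ (Nat.lt_succ_iff.1 h) hdy)
      have diff_eq : F.diff (y - F.diff z) = F.diff y := by rw [map_sub, F.diff_diff, sub_zero]
      have hz' : y - F.diff z ∈ F.fil m k := neg_sub (F.diff z) y ▸ neg_mem hz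
      simpa only [diff_eq] using ih (F.fil_le_grade m k hz') (by rwa [diff_eq]) hz'

theorem AnchorExact.exists_mem_fil_zero_sub_mem_boundaries (hF : F.AnchorExact) {k : ZMod d}
    {y : F.carrier} (hy : y ∈ F.cycles k) : ∃ x ∈ F.fil 0 k, y - x ∈ F.boundaries k := by
  obtain ⟨m, hm⟩ := F.exhaustive k y hy.1
  induction m generalizing y with
  | zero => exact ⟨y, hm, by rw [sub_self]; exact zero_mem _⟩
  | succ m ih =>
    have hdy : F.diff y = 0 := hy.2
    obtain ⟨z, hz, hzy⟩ := anchorExact_iff.1 hF m k y hm (by rw [hdy]; exact zero_mem _)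
    have hz' : y - F.diff z ∈ F.fil m k := neg_sub (F.diff z) y ▸ neg_mem hzy
    have cycle : F.diff (y - F.diff z) = 0 := by rw [map_sub, F.diff_diff, hdy, sub_zero]
    obtain ⟨x, hx, hxy⟩ := ih ⟨F.fil_le_grade m k hz', cycle⟩ hz'
    have dz_mem : F.diff z ∈ F.boundaries k :=
      Submodule.mem_map_of_mem (F.fil_le_grade _ _ hz)
    exact ⟨x, hx, by simpa only [sub_right_comm, sub_add_cancel] using add_mem hxy dz_mem⟩

end Anchor

section Cone

variable {F : GrFlag.{u, v} R d} {D : GrDiffMod.{u, v} R d} {ε : Hom F.toGrDiffMod D}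

/-- The mapping cone of `ε : F → D` is acyclic relative to the family `F^{n-1}_{k-1} × D_k`. -/
def ConeAcyclic (ε : Hom F.toGrDiffMod D) : Prop :=
  FilteredAcyclic ε.coneDiff fun n k => (F.filPred n (k - 1)).prod (D.grade k)

theorem coneAcyclic_iff :
    ConeAcyclic ε ↔ ∀ n k, ∀ a ∈ F.filPred n (k - 1), ∀ b ∈ D.grade k,
      F.diff a = 0 → ε.toLin a = D.diff b →
      ∃ y ∈ F.fil n k, ∃ w ∈ D.grade (k + 1), F.diff y = a ∧ ε.toLin y - D.diff w = b := by
  constructor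
  · intro h n k a ha b hb hda hab
    obtain ⟨⟨y, w⟩, ⟨hy, hw⟩, hyw⟩ := h.exists_diff_eq n k (a, b) ⟨ha, hb⟩
      (Prod.ext hda (sub_eq_zero.2 hab))
    rw [add_sub_cancel_right] at hy
    exact ⟨y, hy, w, hw, Prod.ext_iff.1 hyw⟩
  · refine fun h => ⟨fun n k => Submodule.prod_mono (F.filPred_mono _ n.le_succ) le_rfl, ?_⟩
    rintro n k ⟨a, b⟩ ⟨ha, hb⟩ hab
    obtain ⟨y, hy, w, hw, hya, hwb⟩ := h n k a ha b hb (congrArg Prod.fst hab)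
      (sub_eq_zero.1 (congrArg Prod.snd hab))
    exact ⟨(y, w), ⟨by rwa [add_sub_cancel_right], hw⟩, Prod.ext hya hwb⟩

theorem coneAcyclic_of_isQuasiIso (hε : ε.IsQuasiIso) (hF : F.AnchorExact) : ConeAcyclic ε := by
  refine coneAcyclic_iff.2 fun n k a ha b hb hda hab => ?_
  have hk : k - 1 + 1 = k := sub_add_cancel k 1
  obtain ⟨y₀, hy₀, rfl⟩ : a ∈ F.boundaries (k - 1) :=
    (ε.homologyMap_injective_iff _).1 (hε _).1 a
      ⟨F.fil_le_grade _ _ (F.filPred_le_fil _ _ ha), hda⟩ ⟨b, by rwa [hk], hab.symm⟩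
  obtain ⟨y, hy, hdy⟩ := hF.exists_mem_fil_diff_eq (hk ▸ hy₀) ha
  have defect_cycle : D.diff (ε.toLin y - b) = 0 := by rw [map_sub, ε.comm, hdy, hab, sub_self]
  obtain ⟨c, hc, w, hw, hcw⟩ := (ε.homologyMap_surjective_iff k).1 (hε k).2 (ε.toLin y - b)
    ⟨sub_mem (ε.map_mem k y (F.fil_le_grade _ _ hy)) hb, defect_cycle⟩
  obtain ⟨c₀, hc₀, z, hz, hzc⟩ := hF.exists_mem_fil_zero_sub_mem_boundaries hc
  refine ⟨y - c₀, sub_mem hy (F.fil_mono k n.zero_le hc₀), ε.toLin z - w,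
    sub_mem (ε.map_mem _ z hz) hw, ?_, ?_⟩
  · rw [map_sub, F.diff_fil_zero k c₀ hc₀, sub_zero, hdy]
  · rw [map_sub D.diff, hcw, ε.comm, hzc, map_sub, map_sub]
    abel

theorem ConeAcyclic.isQuasiIso (hε : ConeAcyclic ε) : ε.IsQuasiIso := by
  refine fun j => ⟨(ε.homologyMap_injective_iff j).2 fun x hx => ?_,
    (ε.homologyMap_surjective_iff j).2 fun y hy => ?_⟩
  · rintro ⟨b, hb, hbx⟩
    obtain ⟨n, hn⟩ := F.exhaustive j x hx.1
    obtain ⟨y, hy, -, -, hyx, -⟩ := coneAcyclic_iff.1 hε (n + 1) (j + 1) x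
      (by rwa [add_sub_cancel_right]) b hb hx.2 hbx.symm
    exact ⟨y, F.fil_le_grade _ _ hy, hyx⟩
  · have hdy : D.diff y = 0 := hy.2
    obtain ⟨x, hx, w, hw, hdx, hxw⟩ := coneAcyclic_iff.1 hε 0 j 0 (zero_mem _) y hy.1
      (map_zero _) (by rw [hdy, map_zero])
    exact ⟨x, ⟨F.fil_le_grade _ _ hx, hdx⟩, w, hw, by rw [← hxw, sub_sub_cancel]⟩

theorem ConeAcyclic.anchorExact (hε : ConeAcyclic ε) : F.AnchorExact := by
  rw [coneAcyclic_iff] at hε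
  refine anchorExact_iff.2 fun i k x hx hdx => ?_
  obtain ⟨x', hx', w, hw, hdx', hw'⟩ := hε i k (F.diff x) hdx (ε.toLin x)
    (ε.map_mem _ x (F.fil_le_grade _ _ hx)) (F.diff_diff x) (ε.comm x).symm
  obtain ⟨z, hz, -, -, hdz, -⟩ := hε (i + 2) (k + 1) (x - x')
    (by rw [add_sub_cancel_right]; exact sub_mem hx (F.fil_le_succ _ _ hx')) (-w) (neg_mem hw)
    (by rw [map_sub, hdx', sub_self]) (by rw [map_sub, ← hw', map_neg, sub_sub_cancel_left])
  exact ⟨z, hz, by rw [hdz, sub_sub_cancel_left]; exact neg_mem hx'⟩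

theorem ConeAcyclic.exists_augmentation (hε : ConeAcyclic ε) {k₁ k₀ j : ZMod d}
    (h : k₁ = k₀ + 1) (hj : k₀ = j) :
    ∃ π : F.gr 0 k₀ →ₗ[R] D.homology j,
      Function.Exact (F.grDiff 0 k₁ k₀ h) π ∧ Function.Surjective π := by
  subst hj h
  rw [coneAcyclic_iff] at hε
  have map_cycles : ∀ x ∈ F.fil 0 k₀, ε.toLin x ∈ D.cycles k₀ := fun x hx =>
    ε.map_cycles k₀ x ⟨F.fil_le_grade _ _ hx, F.diff_fil_zero _ x hx⟩
  have map_filPred : (F.filPred 0 k₀).submoduleOf (F.fil 0 k₀) ≤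
      ((D.boundaries k₀).submoduleOf (D.cycles k₀)).comap (ε.toLin.restrict map_cycles) := by
    intro x hx
    have hx₀ : (x : F.carrier) = 0 := hx
    change ε.toLin x ∈ D.boundaries k₀
    rw [hx₀, map_zero]
    exact zero_mem _
  let π := Submodule.mapQ _ _ _ map_filPred
  have ker_le_range : LinearMap.ker π ≤ LinearMap.range (F.grDiff 0 _ k₀ rfl) := by
    intro x hx
    obtain ⟨⟨x, hx₀⟩, rfl⟩ := Submodule.Quotient.mk_surjective _ x
    obtain ⟨w, hw, hwx⟩ : ε.toLin x ∈ D.boundaries k₀ :=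
      (Submodule.Quotient.mk_eq_zero ((D.boundaries k₀).submoduleOf (D.cycles k₀))).1 hx
    obtain ⟨y, hy, -, -, hdy, -⟩ := hε 1 (k₀ + 1) x (by rwa [add_sub_cancel_right]) w hw
      (F.diff_fil_zero _ x hx₀) hwx.symm
    exact ⟨Submodule.Quotient.mk ⟨y, hy⟩, congrArg _ (Subtype.ext hdy)⟩
  have range_le_ker : LinearMap.range (F.grDiff 0 _ k₀ rfl) ≤ LinearMap.ker π := by
    rintro _ ⟨y, rfl⟩
    obtain ⟨⟨y, hy⟩, rfl⟩ := Submodule.Quotient.mk_surjective _ y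
    exact (Submodule.Quotient.mk_eq_zero _).2
      ⟨ε.toLin y, ε.map_mem _ y (F.fil_le_grade _ _ hy), ε.comm y⟩
  refine ⟨π, LinearMap.exact_iff.2 (ker_le_range.antisymm range_le_ker), fun y => ?_⟩
  obtain ⟨⟨y, hy, hdy⟩, rfl⟩ := Submodule.Quotient.mk_surjective _ y
  obtain ⟨x, hx, w, hw, -, hxw⟩ := hε 0 k₀ 0 (zero_mem _) y hy (map_zero _)
    ((map_zero _).trans hdy.symm)
  have dw_eq : D.diff w = ε.toLin x - y := by rw [← hxw, sub_sub_cancel]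
  exact ⟨Submodule.Quotient.mk ⟨x, hx⟩, (Submodule.Quotient.eq _).2 ⟨w, hw, dw_eq⟩⟩

theorem ConeAcyclic.anchorResolves (hε : ConeAcyclic ε) (hF : F.IsProjective) (j : ZMod d) :
    F.AnchorResolves j (D.homology j) :=
  ⟨fun _ => hF _ _, hε.anchorExact j, hε.exists_augmentation _ (by rw [Nat.cast_zero, zero_add])⟩

variable {F' : GrFlag.{u, v} R d} {ε' : Hom F'.toGrDiffMod D}

theorem IsProjective.exists_lift (hF : F.IsProjective) (hε' : ConeAcyclic ε')
    (φ : Hom F.toGrDiffMod D) :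
    ∃ ψ : Hom F.toGrDiffMod F'.toGrDiffMod, FlagPreserving ψ ∧ Homotopic (ε'.comp ψ) φ := by
  -- With these signs the first component of `H` commutes with the differentials.
  obtain ⟨H, hH, H_eq⟩ := hF.exists_contraction hε'.neg
    (g := -(LinearMap.inr R F'.carrier D.carrier ∘ₗ φ.toLin))
    (fun x => by simp [Hom.coneDiff_apply, φ.comm])
    (fun n k x hx => neg_mem ⟨zero_mem _, φ.map_mem k x (F.fil_le_grade n k hx)⟩)
  have lift_mem (n k x) (hx : x ∈ F.fil n k) : (H x).1 ∈ F'.fil n k :=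
    add_sub_cancel_right k 1 ▸ (hH n k x hx).1
  have lift_comm (x) : F'.diff (H x).1 = (H (F.diff x)).1 := by
    have h : -0 = -F'.diff (H x).1 + (H (F.diff x)).1 := congrArg Prod.fst (H_eq x)
    exact neg_add_eq_zero.1 (h.symm.trans neg_zero)
  have homotopy_eq (x) : ε'.toLin (H x).1 - φ.toLin x = D.diff (H x).2 + (H (F.diff x)).2 := by
    have h : -φ.toLin x = -(ε'.toLin (H x).1 - D.diff (H x).2) + (H (F.diff x)).2 :=
      congrArg Prod.snd (H_eq x)
    rw [sub_eq_add_neg, h]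
    abel
  refine ⟨⟨LinearMap.fst R _ _ ∘ₗ H, fun k x hx => ?_, lift_comm⟩, lift_mem,
    LinearMap.snd R _ _ ∘ₗ H, fun k x hx => ?_, homotopy_eq⟩
  · obtain ⟨n, hn⟩ := F.exhaustive k x hx
    exact F'.fil_le_grade n k (lift_mem n k x hn)
  · obtain ⟨n, hn⟩ := F.exhaustive k x hx
    exact (hH n k x hn).2

theorem IsProjective.flagHomotopic (hF : F.IsProjective) (hε' : ConeAcyclic ε')
    {f g : Hom F.toGrDiffMod F'.toGrDiffMod} (hf : FlagPreserving f) (hg : FlagPreserving g)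
    (hfg : Homotopic (ε'.comp f) (ε'.comp g)) : FlagHomotopic f g := by
  obtain ⟨s, hs, hs'⟩ := hfg
  have comm (x) : F'.diff (f.toLin x - g.toLin x) = f.toLin (F.diff x) - g.toLin (F.diff x) := by
    rw [map_sub, f.comm, g.comm]
  have homotopy (x) : ε'.toLin (f.toLin x - g.toLin x) - D.diff (s x) = s (F.diff x) := by
    rw [map_sub]
    exact sub_eq_of_eq_add' (hs' x)
  obtain ⟨H, hH, H_eq⟩ := hF.exists_contraction hε'.shift (g := (f.toLin - g.toLin).prod s)
    (fun x => Prod.ext (comm x) (homotopy x))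
    (fun n k x hx => ⟨by rw [add_sub_cancel_right]; exact sub_mem (hf n k x hx) (hg n k x hx),
      hs k x (F.fil_le_grade n k hx)⟩)
  exact ⟨LinearMap.fst R _ _ ∘ₗ H,
    fun n k x hx => add_sub_cancel_right (k + 1) 1 ▸ (hH n k x hx).1,
    fun x => congrArg Prod.fst (H_eq x)⟩

end Cone

end GrFlag

namespace AnchoredResolution

open GrDiffMod GrFlag

variable {R : Type u} [CommRing R] {d : ℕ} {D : GrDiffMod.{u, v} R d}

theorem coneAcyclic_aug (F : AnchoredResolution D) : ConeAcyclic F.aug :=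
  coneAcyclic_of_isQuasiIso F.isQuasiIso fun j => (F.anchorResolves j).2.1

theorem flagHomotopic_id (F : AnchoredResolution D)
    {f : Hom F.flag.toGrDiffMod F.flag.toGrDiffMod} (hf : FlagPreserving f)
    (h : Homotopic (F.aug.comp f) F.aug) : FlagHomotopic f (Hom.id F.flag.toGrDiffMod) :=
  F.isProjective.flagHomotopic F.coneAcyclic_aug hf (fun _ _ _ hx => hx) h

theorem flagHomotopyEquivalent (F F' : AnchoredResolution D) :
    FlagHomotopyEquivalent F.flag F'.flag := by
  obtain ⟨f, hf, hf'⟩ := F.isProjective.exists_lift F'.coneAcyclic_aug F.aug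
  obtain ⟨g, hg, hg'⟩ := F'.isProjective.exists_lift F.coneAcyclic_aug F'.aug
  exact ⟨f, g, hf, hg,
    F.flagHomotopic_id (fun n k x hx => hg n k _ (hf n k x hx)) ((hg'.comp_right f).trans hf'),
    F'.flagHomotopic_id (fun n k x hx => hf n k _ (hg n k x hx)) ((hf'.comp_right g).trans hg')⟩

/-- The anchored resolution given by a projective flag with a cone-acyclic augmentation. -/
def ofConeAcyclic {F : GrFlag.{u, v} R d} {ε : Hom F.toGrDiffMod D} (hF : F.IsProjective)
    (hε : ConeAcyclic ε) : AnchoredResolution D where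
  flag := F
  aug := ε
  isQuasiIso := hε.isQuasiIso
  isProjective := hF
  anchorResolves := hε.anchorResolves hF

end AnchoredResolution

section Supported

theorem projective_quotient_of_ker_eq {R M P : Type*} [Ring R] [AddCommGroup M] [Module R M]
    [AddCommGroup P] [Module R P] [Module.Projective R P] {f : M →ₗ[R] P} {N : Submodule R M}
    (hf : Function.Surjective f) (hN : LinearMap.ker f = N) : Module.Projective R (M ⧸ N) :=
  .of_equiv (Submodule.quotEquivOfEq _ _ hN.symm ≪≫ₗ f.quotKerEquivOfSurjective hf).symm

variable {R α : Type*} [Ring R]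

theorem linearCombination_mem_of_mem_supported {M : Type*} [AddCommGroup M] [Module R M]
    {v : α → M} {S : Set α} {N : Submodule R M} (h : ∀ p ∈ S, v p ∈ N) {a : α →₀ R}
    (ha : a ∈ Finsupp.supported R R S) : Finsupp.linearCombination R v a ∈ N := by
  rw [Finsupp.linearCombination_apply]
  exact N.sum_mem fun p hp => N.smul_mem _ (h p (ha hp))

theorem isInternal_supported_fiber {ι : Type*} [DecidableEq ι] (f : α → ι) :
    DirectSum.IsInternal fun i => Finsupp.supported R R {p | f p = i} := by
  refine DirectSum.isInternal_submodule_of_iSupIndep_of_iSup_eq_top (fun i => ?_) ?_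
  · have fiber_disjoint : Disjoint {p | f p = i} {p | f p ≠ i} :=
      Set.disjoint_left.2 fun p hp hp' => hp' hp
    have iSup_le : ⨆ (j) (_ : j ≠ i), Finsupp.supported R R {p | f p = j} ≤
        Finsupp.supported R R {p | f p ≠ i} :=
      iSup₂_le fun j hj => Finsupp.supported_mono fun p hp hp' => hj (hp.symm.trans hp')
    exact (Finsupp.disjoint_supported_supported fiber_disjoint).mono_right iSup_le
  · rw [← Finsupp.supported_iUnion, ← Finsupp.supported_univ, ← Set.preimage_univ (f := f),
      ← Set.iUnion_of_singleton, Set.preimage_iUnion]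
    rfl

theorem exists_surjective_ker_eq_supported (S T : Set α) :
    ∃ f : Finsupp.supported R R S →ₗ[R] Finsupp.supported R R (S \ T), Function.Surjective f ∧
      LinearMap.ker f = (Finsupp.supported R R T).submoduleOf (Finsupp.supported R R S) := by
  classical
  refine ⟨Finsupp.restrictDom R R (S \ T) ∘ₗ Submodule.subtype _, fun x => ?_, ?_⟩
  · exact ⟨⟨x, Finsupp.supported_mono Set.sdiff_subset x.2⟩,
      LinearMap.congr_fun (Finsupp.restrictDom_comp_subtype (R := R) (M := R) (S \ T)) x⟩
  · ext x
    calc x ∈ LinearMap.ker _ ↔ Finsupp.filter (· ∈ S \ T) (x : α →₀ R) = 0 := by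
          rw [LinearMap.mem_ker, ← Subtype.coe_inj]; rfl
      _ ↔ ∀ p ∉ T, (x : α →₀ R) p = 0 := by
          rw [Finsupp.filter_eq_zero_iff]
          exact ⟨fun h p hT => by_contra fun hp =>
            hp (h p ⟨x.2 (Finsupp.mem_support_iff.2 hp), hT⟩), fun h p hp => h p hp.2⟩
      _ ↔ x ∈ (Finsupp.supported R R T).submoduleOf _ := (Finsupp.mem_supported' R _).symm

end Supported

namespace GrDiffMod

variable {R : Type u} [CommRing R] {d : ℕ}

/-- Formal cells over `D`: a cell has a level, a degree, a boundary, which is a formal linear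
combination `∑ i, c i • x i` of cells, and a value `b` in `D`. -/
inductive Cell (D : GrDiffMod.{u, v} R d) : Type (max u v)
  | mk (level : ℕ) (deg : ZMod d) (n : ℕ) (c : Fin n → R) (x : Fin n → Cell D) (b : D.carrier)

namespace Cell

variable {D : GrDiffMod.{u, v} R d}

/-- The filtration level in which a cell is attached. -/
def level : Cell D → ℕ
  | mk l _ _ _ _ _ => l

/-- The degree of a cell. -/
def deg : Cell D → ZMod d
  | mk _ k _ _ _ _ => k

open Classical in
/-- The boundary and the value of a cell, which form a cycle of the mapping cone of the
augmentation of `cellFlag`. A cell whose data do not describe such a cycle, of lower level and the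
right degree, is kept with boundary and value `0`. -/
noncomputable def attachingCycle : Cell D → (Cell D →₀ R) × D.carrier
  | mk l k _ c x b =>
    if (∀ i, (x i).level < l ∧ (x i).deg = k - 1) ∧ b ∈ D.grade k ∧
        ∑ i, c i • (x i).attachingCycle = (0, D.diff b)
      then (∑ i, Finsupp.single (x i) (c i), b)
      else 0

/-- The linear extension of `attachingCycle`. Its components are the differential and the
augmentation of `cellFlag`. -/
noncomputable def attach (D : GrDiffMod.{u, v} R d) :
    (Cell D →₀ R) →ₗ[R] (Cell D →₀ R) × D.carrier :=
  Finsupp.linearCombination R attachingCycle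

theorem attach_single (p : Cell D) (r : R) :
    attach D (Finsupp.single p r) = r • p.attachingCycle :=
  Finsupp.linearCombination_single R r p

theorem attachingCycle_mem (p : Cell D) :
    p.attachingCycle ∈ (Finsupp.supported R R
      {q : Cell D | q.level < p.level ∧ q.deg = p.deg - 1}).prod (D.grade p.deg) := by
  obtain ⟨l, k, n, c, x, b⟩ := p
  rw [attachingCycle]
  split_ifs with h
  · exact ⟨sum_mem fun i _ => Finsupp.single_mem_supported _ _ (h.1 i), h.2.1⟩
  · exact zero_mem _

theorem attach_mem_of_mem_grade {k : ZMod d} {a : Cell D →₀ R}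
    (ha : a ∈ Finsupp.supported R R {p : Cell D | p.deg = k}) :
    attach D a ∈ (Finsupp.supported R R {q : Cell D | q.deg = k - 1}).prod (D.grade k) := by
  refine linearCombination_mem_of_mem_supported ?_ ha
  rintro p rfl
  exact Submodule.prod_mono (Finsupp.supported_mono fun _ hq => hq.2) le_rfl p.attachingCycle_mem

theorem attach_mem_of_mem_fil {n : ℕ} {k : ZMod d} {a : Cell D →₀ R}
    (ha : a ∈ Finsupp.supported R R {p : Cell D | p.level < n + 1 ∧ p.deg = k}) :
    attach D a ∈ (Finsupp.supported R R {q : Cell D | q.level < n ∧ q.deg = k - 1}).prod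
      (D.grade k) := by
  refine linearCombination_mem_of_mem_supported ?_ ha
  rintro p ⟨hp, rfl⟩
  exact Submodule.prod_mono (Finsupp.supported_mono fun _ hq =>
    And.imp_left (fun h => h.trans_le (Nat.lt_succ_iff.1 hp)) hq) le_rfl p.attachingCycle_mem

theorem attach_attachingCycle (p : Cell D) :
    attach D p.attachingCycle.1 = (0, D.diff p.attachingCycle.2) := by
  obtain ⟨l, k, n, c, x, b⟩ := p
  rw [attachingCycle]
  split_ifs with h
  · simpa only [map_sum, attach_single] using h.2.2
  · simp only [Prod.fst_zero, Prod.snd_zero, map_zero, Prod.mk_zero_zero]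

theorem attach_attach (a : Cell D →₀ R) : attach D (attach D a).1 = (0, D.diff (attach D a).2) := by
  have : attach D ∘ₗ LinearMap.fst R _ _ ∘ₗ attach D =
      LinearMap.inr R _ _ ∘ₗ D.diff ∘ₗ LinearMap.snd R _ _ ∘ₗ attach D :=
    Finsupp.lhom_ext' fun p => LinearMap.ext_ring <| by
      simp [attach_single, attach_attachingCycle]
  exact LinearMap.congr_fun this a

theorem exists_attachingCycle_eq {n : ℕ} {k : ZMod d} {a : Cell D →₀ R} {b : D.carrier}
    (ha : a ∈ Finsupp.supported R R {q : Cell D | q.level < n ∧ q.deg = k - 1})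
    (hb : b ∈ D.grade k) (hab : attach D a = (0, D.diff b)) :
    ∃ p : Cell D, p.level = n ∧ p.deg = k ∧ p.attachingCycle = (a, b) := by
  let e := a.support.equivFin.symm
  have a_eq : ∑ i, Finsupp.single (e i : Cell D) (a (e i)) = a := by
    rw [e.sum_comp fun x : a.support => Finsupp.single (x : Cell D) (a x),
      Finset.sum_coe_sort a.support fun x => Finsupp.single x (a x)]
    exact a.sum_single
  have cycle_eq : ∑ i, a (e i) • (e i : Cell D).attachingCycle = (0, D.diff b) := by
    simpa only [map_sum, attach_single] using (congrArg (attach D) a_eq).trans hab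
  refine ⟨mk n k _ (fun i => a (e i)) (fun i => e i) b, rfl, rfl, ?_⟩
  rw [attachingCycle, if_pos ⟨fun i => ha (e i).2, hb, cycle_eq⟩, a_eq]

end Cell

/-- The free flag on the cells over `D`. -/
noncomputable def cellFlag (D : GrDiffMod.{u, max u v} R d) : GrFlag.{u, max u v} R d where
  carrier := Cell D →₀ R
  grade k := Finsupp.supported R R {p | p.deg = k}
  isInternal := isInternal_supported_fiber Cell.deg
  diff := LinearMap.fst R _ _ ∘ₗ Cell.attach D
  diff_diff a := congrArg Prod.fst (Cell.attach_attach a)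
  diff_mem _ _ ha := (Cell.attach_mem_of_mem_grade ha).1
  fil n k := Finsupp.supported R R {p | p.level < n + 1 ∧ p.deg = k}
  fil_le_grade _ _ := Finsupp.supported_mono fun _ hp => hp.2
  fil_le_succ _ _ := Finsupp.supported_mono fun _ hp => ⟨hp.1.trans (Nat.lt_succ_self _), hp.2⟩
  exhaustive j a ha := ⟨a.support.sup Cell.level, fun _ hp =>
    ⟨Nat.lt_succ_of_le (Finset.le_sup hp), ha hp⟩⟩
  diff_fil_zero j a ha := by
    simpa using (Cell.attach_mem_of_mem_fil ha).1
  diff_fil_succ i j _ ha := (Cell.attach_mem_of_mem_fil ha).1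

theorem filPred_cellFlag (D : GrDiffMod.{u, max u v} R d) (n : ℕ) (k : ZMod d) :
    (cellFlag.{u, v} D).filPred n k =
      Finsupp.supported R R {p : Cell D | p.level < n ∧ p.deg = k} := by
  cases n with
  | zero =>
    simp only [Nat.not_lt_zero, false_and, Set.ofPred_false, Finsupp.supported_empty]
    rfl
  | succ n => rfl

theorem isProjective_cellFlag (D : GrDiffMod.{u, max u v} R d) :
    (cellFlag.{u, v} D).IsProjective := fun n k => by
  let newCells : Set (Cell D) := {p | p.level < n + 1 ∧ p.deg = k} \ {p | p.level < n ∧ p.deg = k}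
  have := Module.Projective.of_equiv (Finsupp.supportedEquivFinsupp (M := R) (R := R) newCells).symm
  obtain ⟨f, hf, ker_f⟩ : ∃ f : (cellFlag.{u, v} D).fil n k →ₗ[R] Finsupp.supported R R newCells,
      Function.Surjective f ∧
        LinearMap.ker f = ((cellFlag.{u, v} D).filPred n k).submoduleOf _ := by
    rw [filPred_cellFlag]
    exact exists_surjective_ker_eq_supported _ _
  exact projective_quotient_of_ker_eq (P := Finsupp.supported R R newCells) hf ker_f

/-- The augmentation of `cellFlag D`, which sends a cell to its value. -/
noncomputable def cellFlagAug (D : GrDiffMod.{u, max u v} R d) :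
    Hom (cellFlag.{u, v} D).toGrDiffMod D where
  toLin := LinearMap.snd R _ _ ∘ₗ Cell.attach D
  map_mem _ _ ha := (Cell.attach_mem_of_mem_grade ha).2
  comm a := (congrArg Prod.snd (Cell.attach_attach a)).symm

theorem coneAcyclic_cellFlagAug (D : GrDiffMod.{u, max u v} R d) :
    GrFlag.ConeAcyclic (cellFlagAug.{u, v} D) := by
  refine GrFlag.coneAcyclic_iff.2 fun n k a ha b hb hda hab => ?_
  rw [filPred_cellFlag] at ha
  obtain ⟨p, rfl, rfl, hp⟩ := Cell.exists_attachingCycle_eq ha hb (Prod.ext hda hab)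
  have attach_p : Cell.attach D (Finsupp.single p 1) = (a, b) := by
    rw [Cell.attach_single, one_smul]
    exact hp
  exact ⟨Finsupp.single p (1 : R), Finsupp.single_mem_supported R _ ⟨Nat.lt_succ_self _, rfl⟩, 0,
    zero_mem _, congrArg Prod.fst attach_p, by
      rw [map_zero, sub_zero]
      exact congrArg Prod.snd attach_p⟩

end GrDiffMod

theorem AnchoredResolution.nonempty {R : Type u} [CommRing R] {d : ℕ}
    (D : GrDiffMod.{u, max u v} R d) : Nonempty (AnchoredResolution D) :=
  ⟨.ofConeAcyclic (GrDiffMod.isProjective_cellFlag.{u, v} D)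
    (GrDiffMod.coneAcyclic_cellFlagAug.{u, v} D)⟩

theorem theorem3p2_general {R : Type u} [CommRing R] (d : ℕ) :
    (∀ D : GrDiffMod.{u, max u v} R d, Nonempty (AnchoredResolution D)) ∧
    (∀ (D : GrDiffMod.{u, w} R d) (F F' : GrFlag.{u, w} R d)
      (φ : GrDiffMod.Hom F.toGrDiffMod D) (ε' : GrDiffMod.Hom F'.toGrDiffMod D),
      F.IsProjective → ε'.IsQuasiIso → F'.AnchorExact →
      ∃ ψ : GrDiffMod.Hom F.toGrDiffMod F'.toGrDiffMod,
        GrFlag.FlagPreserving ψ ∧ GrDiffMod.Homotopic (ε'.comp ψ) φ) ∧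
    (∀ (D : GrDiffMod.{u, w} R d) (F F' : AnchoredResolution D),
      GrFlag.FlagHomotopyEquivalent F.flag F'.flag) :=
  ⟨AnchoredResolution.nonempty.{u, v},
    fun _ _ _ φ _ hF hε' hF' => hF.exists_lift (GrFlag.coneAcyclic_of_isQuasiIso hε' hF') φ,
    fun _ => AnchoredResolution.flagHomotopyEquivalent⟩

theorem theorem3p2 {R : Type u} [CommRing R] (d : ℕ) :
    -- every differential module has an anchored resolution
    (∀ D : GrDiffMod.{u, max u v} R d, Nonempty (AnchoredResolution D)) ∧
    -- lifting of morphisms to any given anchored resolutions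
    (∀ (D D' : GrDiffMod.{u, max u v} R d) (φ : GrDiffMod.Hom D D')
      (F : AnchoredResolution D) (F' : AnchoredResolution D'),
      ∃ ψ : GrDiffMod.Hom F.flag.toGrDiffMod F'.flag.toGrDiffMod,
        GrFlag.FlagPreserving ψ ∧
        GrDiffMod.Homotopic (F'.aug.comp ψ) (φ.comp F.aug)) ∧
    -- uniqueness up to flag-preserving homotopy equivalence
    (∀ (D : GrDiffMod.{u, max u v} R d) (F F' : AnchoredResolution D),
      GrFlag.FlagHomotopyEquivalent F.flag F'.flag) := by
  obtain ⟨exists_resolution, lift, unique⟩ := theorem3p2_general.{u, v, max u v} (R := R) d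
  exact ⟨exists_resolution, fun D D' φ F F' => lift D' F.flag F'.flag (φ.comp F.aug) F'.aug
    F.isProjective F'.isQuasiIso fun j => (F'.anchorResolves j).2.1, unique⟩
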